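/- Consider a Markov decision process with a finite state space $\mathcal S$ and finite nonempty sets of available actions. Action $a$ in state $s$ leads to state $s'$ with probability $P_a(s,s')$ and yields a reward $R_a(s,s')\in\mathbb R$ and a difficulty contribution $D_a(s,s')\ge 0$. A policy $\pi$ is a deterministic map that assigns to every state one of its available actions; it induces a Markov chain $Y_1,Y_2,\dots$ on $\mathcal S$ with $Y_1=s_{\mathrm{init}}$, where $s_{\mathrm{init}}$ is a fixed initial state. Let $R_t$ and $D_t$ be the reward and the difficulty contribution of the transition from $Y_t$ to $Y_{t+1}$, and let $\mathbb E^\pi$ be the expectation under $\pi$. Assume: 1. there is $R_{\max}>0$ such that $|R_t|\le R_{\max}$ almost surely for all policies and all $t\ge1$; 2. there is $D_{\max}>0$ such that $0\le D_t\le D_{\max}$ almost surely for all policies and all $t\ge 1$; 3. there is $\varepsilon>0$ such that $\mathbb E^\pi\big[\lim_{T\to\infty}\frac1T\sum_{t=1}^T D_t\big]>\varepsilon$ for every policy $\pi$; 4. under every policy, $s_{\mathrm{init}}$ is positive recurrent: the chain started in $s_{\mathrm{init}}$ returns to it almost surely, and the expected return time is finite. The ARR-MDP revenue of $\pi$ is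 $$\mathrm{REV}_{\mathrm{ARR}}^\pi=\mathbb E^\pi\Big[\lim_{T\to\infty}\frac{\sum_{t=1}^T R_t}{\sum_{t=1}^T D_t}\Big].$$ For $H>1$, the PT-MDP with expected horizon $H$ is the same process started in $s_{\mathrm{init}}$, except that in every step $t$, given the transition and its difficulty contribution $D_t$, an independent coin lets the process continue with probability $(1-\frac1H)^{D_t}$; otherwise the process moves to an absorbing terminal state, in which no further reward is obtained. With $\mathrm{Term}(H)$ the step in which it terminates, the PT-MDP revenue of $\pi$ is $$\mathrm{REV}_{\mathrm{PT}}^\pi(H)=\mathbb E^\pi\Big[\frac1H\sum_{t=1}^{\mathrm{Term}(H)}R_t\Big].$$ Then both revenues are well defined for every policy $\pi$ and every $H>1$: the limit in $\mathrm{REV}_{\mathrm{ARR}}^\pi$ exists almost surely, $\mathrm{Term}(H)$ is almost surely finite, and the random variables whose expectations are taken are integrable. Moreover, $$\lim_{H\to\infty}\max_\pi \mathrm{REV}_{\mathrm{PT}}^\pi(H)=\max_\pi\mathrm{REV}_{\mathrm{ARR}}^\pi .$$ Consequently, for every $\delta>0$ and all sufficiently large $H$, every policy $\pi$ that maximizes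 $\mathrm{REV}_{\mathrm{PT}}^{\pi}(H)$ satisfies $\mathrm{REV}_{\mathrm{ARR}}^\pi>\max_{\pi'}\mathrm{REV}_{\mathrm{ARR}}^{\pi'}-\delta$. -/

import Mathlib

open MeasureTheory ProbabilityTheory Filter Topology
open scoped NNReal ENNReal

/-- A Markov decision process with state space `S` and action sets `A s`: transition probabilities
`P s a s'`, rewards `R s a s'` and nonnegative difficulty contributions `D s a s'`. -/
structure ARRMDP (S : Type*) (A : S → Type*) where
  P : ∀ s, A s → PMF S
  R : ∀ s, A s → S → ℝ
  D : ∀ s, A s → S → ℝ≥0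

namespace ARRMDP

noncomputable section

variable {S : Type*} {A : S → Type*}

/-- A policy: a deterministic choice of an available action in every state. -/
abbrev Policy (A : S → Type*) : Type _ := ∀ s, A s

section Chain

variable [Fintype S] [MeasurableSpace S] [MeasurableSingletonClass S]

/-- The one-step transition kernel of the Markov chain induced by the policy `π`. -/
def stepKernel (M : ARRMDP S A) (π : Policy A) : Kernel S S :=
  Kernel.ofFunOfCountable fun s => (M.P s (π s)).toMeasure

instance (M : ARRMDP S A) (π : Policy A) : IsMarkovKernel (M.stepKernel π) :=
  ⟨fun s => by
    change IsProbabilityMeasure (M.P s (π s)).toMeasure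
    infer_instance⟩

/-- The same kernel, as a kernel on histories that only looks at the current state. -/
def historyKernel (M : ARRMDP S A) (π : Policy A) (n : ℕ) :
    Kernel (∀ _ : Finset.Iic n, S) S :=
  (M.stepKernel π).comap (fun h => h ⟨n, Finset.mem_Iic.2 le_rfl⟩) (measurable_pi_apply _)

instance (M : ARRMDP S A) (π : Policy A) (n : ℕ) : IsMarkovKernel (M.historyKernel π n) := by
  unfold historyKernel
  infer_instance

/-- The law, on trajectories `ω : ℕ → S`, of the Markov chain induced by `π` and started in `s`. -/
def law (M : ARRMDP S A) (π : Policy A) (s : S) : Measure (ℕ → S) :=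
  Kernel.trajMeasure (X := fun _ => S) (Measure.dirac s) (M.historyKernel π)

end Chain

/-- The reward `R_{t+1}` of the transition from `ω t` to `ω (t + 1)`. -/
def reward (M : ARRMDP S A) (π : Policy A) (t : ℕ) (ω : ℕ → S) : ℝ :=
  M.R (ω t) (π (ω t)) (ω (t + 1))

/-- The difficulty contribution `D_{t+1}` of the transition from `ω t` to `ω (t + 1)`. -/
def difficulty (M : ARRMDP S A) (π : Policy A) (t : ℕ) (ω : ℕ → S) : ℝ :=
  M.D (ω t) (π (ω t)) (ω (t + 1))

/-- The average difficulty contribution of the first `T` steps. -/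
def avgDifficulty (M : ARRMDP S A) (π : Policy A) (ω : ℕ → S) (T : ℕ) : ℝ :=
  (1 / (T : ℝ)) * ∑ t ∈ Finset.range T, M.difficulty π t ω

/-- The ratio of the total reward to the total difficulty contribution of the first `T` steps. -/
def ratio (M : ARRMDP S A) (π : Policy A) (ω : ℕ → S) (T : ℕ) : ℝ :=
  (∑ t ∈ Finset.range T, M.reward π t ω) / ∑ t ∈ Finset.range T, M.difficulty π t ω

/-- The first time `n ≥ 1` at which the trajectory is in state `s` (`⊤` if there is none). -/
def returnTime (s : S) (ω : ℕ → S) : ℕ∞ :=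
  ⨅ (n : ℕ) (_ : 1 ≤ n ∧ ω n = s), (n : ℕ∞)

section Revenue

variable [Fintype S] [MeasurableSpace S] [MeasurableSingletonClass S]

/-- `s` is positive recurrent for the chain induced by `π`: started in `s`, the chain returns to
`s` almost surely, and the expected return time is finite. -/
def PositiveRecurrent (M : ARRMDP S A) (π : Policy A) (s : S) : Prop :=
  (∀ᵐ ω ∂(M.law π s), ∃ n, 1 ≤ n ∧ ω n = s) ∧
    ∫⁻ ω, (returnTime s ω : ℝ≥0∞) ∂(M.law π s) < ∞

/-- `E^π [lim_T (1/T) ∑_{t ≤ T} D_t]`. -/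
def meanDifficulty (M : ARRMDP S A) (sinit : S) (π : Policy A) : ℝ :=
  ∫ ω, limUnder atTop (M.avgDifficulty π ω) ∂(M.law π sinit)

/-- The revenue `E^π [lim_T (∑_{t ≤ T} R_t) / (∑_{t ≤ T} D_t)]`. -/
def revARR (M : ARRMDP S A) (sinit : S) (π : Policy A) : ℝ :=
  ∫ ω, limUnder atTop (M.ratio π ω) ∂(M.law π sinit)

end Revenue

/-- The probability `(1 - 1/H) ^ d` to continue after a difficulty contribution `d`. The base is
clamped to `[0, 1]`, which has no effect for `H ≥ 1`; see `coe_contProb`. -/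
def contProb (H : ℝ) (d : ℝ≥0) : ℝ≥0 := (min 1 (Real.toNNReal (1 - 1 / H))) ^ (d : ℝ)

theorem contProb_le_one (H : ℝ) (d : ℝ≥0) : contProb H d ≤ 1 :=
  NNReal.rpow_le_one (min_le_left _ _) d.2

theorem coe_contProb {H : ℝ} (hH : 1 ≤ H) (d : ℝ≥0) :
    (contProb H d : ℝ) = (1 - 1 / H) ^ (d : ℝ) := by
  have h1 : 1 / H ≤ 1 := by rw [div_le_one (by linarith)]; exact hH
  have h0 : 0 ≤ 1 / H := by positivity
  rw [contProb, NNReal.coe_rpow, NNReal.coe_min, Real.coe_toNNReal _ (by linarith),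
    NNReal.coe_one, min_eq_right (by linarith)]

/-- The coin that shows `true` (continue) with probability `(1 - 1/H) ^ d` and `false` (stop)
otherwise. -/
def coin (H : ℝ) (d : ℝ≥0) : PMF Bool :=
  PMF.ofFintype (fun b => cond b (contProb H d : ℝ≥0∞) (1 - contProb H d)) (by
    have h : (contProb H d : ℝ≥0∞) ≤ 1 := by exact_mod_cast contProb_le_one H d
    simp [h])

/-- The auxiliary process with probabilistic termination and expected horizon `H`, again an MDP.
The state `(i, true)` is the state `i` of the original process. A step from there draws the next
state `j` as in the original process and yields the original reward and difficulty contribution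
`d` of this transition; then a coin decides whether the process continues in `(j, true)`, with
probability `(1 - 1/H) ^ d`, or terminates. The states `(j, false)` together are the terminal
state: it is absorbing and without any reward or difficulty contribution (the label `j` has no
influence on anything that follows; it records the transition in whose course the process
stopped, so that the reward of that step is a function of the two successive states). -/
def pt (M : ARRMDP S A) (H : ℝ) : ARRMDP (S × Bool) (fun x => A x.1) where
  P x a := if x.2 then (M.P x.1 a).bind fun j => (coin H (M.D x.1 a j)).map (Prod.mk j)
    else PMF.pure x
  R x a y := if x.2 then M.R x.1 a y.1 else 0
  D x a y := if x.2 then M.D x.1 a y.1 else 0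

/-- A policy, applied in the process with termination; the action in the terminal state is
irrelevant. -/
def Policy.lift (π : Policy A) : Policy (fun x : S × Bool => A x.1) := fun x => π x.1

/-- `Term(H)`: the (first) step in which the process moves to the terminal state, steps being
numbered from `1`, so that step `t` leads from `ω (t - 1)` to `ω t`. -/
def term (ω : ℕ → S × Bool) : ℕ := sInf {t | 1 ≤ t ∧ (ω t).2 = false}

/-- `(1/H) ∑_{t = 1}^{Term(H)} R_t`. -/
def ptTotal (M : ARRMDP S A) (H : ℝ) (π : Policy A) (ω : ℕ → S × Bool) : ℝ :=
  (1 / H) * ∑ t ∈ Finset.range (term ω), (M.pt H).reward π.lift t ω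

section PTRevenue

variable [Fintype S] [MeasurableSpace S] [MeasurableSingletonClass S]

/-- The law of the process with termination under `π`, started in `sinit`. -/
def ptLaw (M : ARRMDP S A) (sinit : S) (H : ℝ) (π : Policy A) : Measure (ℕ → S × Bool) :=
  (M.pt H).law π.lift (sinit, true)

/-- The revenue `E^π [(1/H) ∑_{t = 1}^{Term(H)} R_t]`. -/
def revPT (M : ARRMDP S A) (sinit : S) (H : ℝ) (π : Policy A) : ℝ :=
  ∫ ω, M.ptTotal H π ω ∂(M.ptLaw sinit H π)

end PTRevenue

/-- The maximum of a function over the finitely many policies. -/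
def maxPolicy [Fintype S] [DecidableEq S] [∀ s, Fintype (A s)] [∀ s, Nonempty (A s)]
    (f : Policy A → ℝ) : ℝ :=
  (Finset.univ : Finset (Policy A)).sup' Finset.univ_nonempty f

end

end ARRMDP

/-! Fix a policy and write `z` for the initial state. Recurrence of `z` means that every state
reachable from `z` leads back to it, so by the maximum principle only constants are harmonic on the
reachable states. Hence for every `g` there are `f` and a constant `c` with `f = g - c + E f` there
(`exists_poisson`). Let `cR` and `cD` be the constants for reward and difficulty.

Without termination, the Poisson equation writes a centred sum along the trajectory as a martingale
plus a bounded telescoping rest. The strong law for martingale differences (`ae_tendsto_avg_zero`)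
then gives time averages `cR` and `cD` almost surely (`ae_tendsto_avg`). The mean difficulty is `cD
> 0`, and the ratio tends to the deterministic value `ρ = cR / cD`.

With termination, the same functions control expected totals up to the terminal step. For reward
minus `ρ` times difficulty the Poisson constant is zero, so the expected total is bounded uniformly
in `H` (`abs_green_sub_le`) and disappears after division by `H`. The stopping probabilities have
expected total one, and each is asymptotically `d / H`, so the expected total difficulty divided by
`H` tends to one (`abs_green_difficulty_sub_one_le`). Together these give the limit `ρ` again
(`tendsto_revPT`). There are finitely many policies, so the convergence is uniform in the policy and
passes to maxima and maximizers. -/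

namespace ARRMDP

noncomputable section

/-! ### One-step means and the Markov property of the trajectory law. -/

section MarkovProperty

variable {S : Type*} {A : S → Type*} [Fintype S]

/-- The expectation of `g s s'` over the state `s'` that follows `s` under the policy `π`. -/
def mean (M : ARRMDP S A) (π : Policy A) (g : S → S → ℝ) (s : S) : ℝ :=
  ∑ s', (M.P s (π s) s').toReal * g s s'

theorem sum_toReal_P (M : ARRMDP S A) (s : S) (a : A s) : ∑ s', (M.P s a s').toReal = 1 := by
  rw [← ENNReal.toReal_sum fun s' _ => (M.P s a).apply_ne_top s',
    ← tsum_fintype (L := .unconditional S), (M.P s a).tsum_coe, ENNReal.toReal_one]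

theorem mean_const (M : ARRMDP S A) (π : Policy A) (c : S → ℝ) (s : S) :
    M.mean π (fun s _ => c s) s = c s := by
  simp only [mean, ← Finset.sum_mul, sum_toReal_P, one_mul]

theorem mean_add (M : ARRMDP S A) (π : Policy A) (g h : S → S → ℝ) (s : S) :
    M.mean π (fun s s' => g s s' + h s s') s = M.mean π g s + M.mean π h s := by
  simp only [mean, mul_add, Finset.sum_add_distrib]

theorem mean_sub (M : ARRMDP S A) (π : Policy A) (g h : S → S → ℝ) (s : S) :
    M.mean π (fun s s' => g s s' - h s s') s = M.mean π g s - M.mean π h s := by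
  simp only [mean, mul_sub, Finset.sum_sub_distrib]

theorem mean_const_mul (M : ARRMDP S A) (π : Policy A) (c : ℝ) (g : S → S → ℝ) (s : S) :
    M.mean π (fun s s' => c * g s s') s = c * M.mean π g s := by
  simp only [mean, Finset.mul_sum, mul_left_comm]

theorem mean_mono (M : ARRMDP S A) (π : Policy A) {g h : S → S → ℝ} {s : S}
    (H : ∀ s', g s s' ≤ h s s') : M.mean π g s ≤ M.mean π h s :=
  Finset.sum_le_sum fun s' _ => mul_le_mul_of_nonneg_left (H s') ENNReal.toReal_nonneg

variable [MeasurableSpace S] [MeasurableSingletonClass S]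

instance (M : ARRMDP S A) (π : Policy A) (s : S) : IsProbabilityMeasure (M.law π s) := by
  unfold law
  infer_instance

theorem integral_stepKernel (M : ARRMDP S A) (π : Policy A) (f : S → ℝ) (s : S) :
    ∫ s', f s' ∂(M.stepKernel π s) = ∑ s', (M.P s (π s) s').toReal * f s' := by
  change ∫ s', f s' ∂(M.P s (π s)).toMeasure = _
  rw [PMF.integral_eq_sum]
  simp

theorem measurable_of_frestrictLe {β : Type*} [MeasurableSpace β] (n : ℕ)
    (F : (∀ _ : Finset.Iic n, S) → β) :
    Measurable fun ω : ℕ → S => F (Preorder.frestrictLe (π := fun _ => S) n ω) :=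
  (measurable_of_countable F).comp (Preorder.measurable_frestrictLe n)

theorem measurable_pair {β : Type*} [MeasurableSpace β] (g : S → S → β) (t : ℕ) :
    Measurable fun ω : ℕ → S => g (ω t) (ω (t + 1)) :=
  Measurable.comp (g := fun x : S × S => g x.1 x.2) (measurable_of_countable _)
    (f := fun ω : ℕ → S => (ω t, ω (t + 1)))
    ((measurable_pi_apply t).prodMk (measurable_pi_apply (t + 1)))

theorem integrable_of_finite_range {ι : Type*} [Finite ι] {Ω : Type*} [MeasurableSpace Ω]
    {μ : Measure Ω} [IsFiniteMeasure μ] (X : Ω → ι) (f : ι → ℝ)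
    (hf : Measurable fun ω => f (X ω)) : Integrable (fun ω => f (X ω)) μ := by
  obtain ⟨C, hC⟩ := (Set.finite_range fun i => ‖f i‖).bddAbove
  exact Integrable.of_bound hf.aestronglyMeasurable C
    (ae_of_all _ fun ω => hC (Set.mem_range_self (X ω)))

theorem integrable_pair (M : ARRMDP S A) (π : Policy A) (s : S) (g : S → S → ℝ) (t : ℕ) :
    Integrable (fun ω => g (ω t) (ω (t + 1))) (M.law π s) :=
  integrable_of_finite_range (fun ω : ℕ → S => (ω t, ω (t + 1))) (fun x => g x.1 x.2)
    (measurable_pair g t)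

theorem integrable_coord (M : ARRMDP S A) (π : Policy A) (s : S) (g : S → ℝ) (t : ℕ) :
    Integrable (fun ω => g (ω t)) (M.law π s) :=
  M.integrable_pair π s (fun s _ => g s) t

/-- The Markov property. -/
theorem integral_history_mul (M : ARRMDP S A) (π : Policy A) (s : S) (n : ℕ)
    (F : (∀ _ : Finset.Iic n, S) → ℝ) (g : S → S → ℝ) :
    ∫ ω, F (Preorder.frestrictLe (π := fun _ => S) n ω) * g (ω n) (ω (n + 1)) ∂(M.law π s) =
      ∫ ω, F (Preorder.frestrictLe (π := fun _ => S) n ω) * M.mean π g (ω n) ∂(M.law π s) := by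
  have key := Kernel.map_frestrictLe_trajMeasure_compProd_eq_map_trajMeasure
    (X := fun _ => S) (μ₀ := Measure.dirac s) (κ := M.historyKernel π) (a := n)
  change (M.law π s).map (Preorder.frestrictLe n) ⊗ₘ _ = (M.law π s).map _ at key
  let G : (∀ _ : Finset.Iic n, S) × S → ℝ :=
    fun x => F x.1 * g (x.1 ⟨n, Finset.mem_Iic.2 le_rfl⟩) x.2
  have hG : Measurable G := measurable_of_countable G
  have hm : Measurable fun x : ℕ → S => (Preorder.frestrictLe (π := fun _ => S) n x, x (n + 1)) :=
    (Preorder.measurable_frestrictLe n).prodMk (measurable_pi_apply (n + 1))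
  have h1 : ∫ ω, F (Preorder.frestrictLe (π := fun _ => S) n ω) * g (ω n) (ω (n + 1)) ∂(M.law π s)
      = ∫ x, G x ∂((M.law π s).map fun x =>
        (Preorder.frestrictLe (π := fun _ => S) n x, x (n + 1))) := by
    rw [integral_map hm.aemeasurable hG.aestronglyMeasurable]
    rfl
  have : IsProbabilityMeasure ((M.law π s).map (Preorder.frestrictLe (π := fun _ => S) n)) :=
    Measure.isProbabilityMeasure_map (Preorder.measurable_frestrictLe n).aemeasurable
  have hi : Integrable G ((M.law π s).map (Preorder.frestrictLe (π := fun _ => S) n) ⊗ₘ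
      M.historyKernel π n) := integrable_of_finite_range id G hG
  rw [h1, ← key, Measure.integral_compProd hi,
    integral_map (Preorder.measurable_frestrictLe n).aemeasurable
      (measurable_of_countable _).aestronglyMeasurable]
  refine integral_congr_ae (ae_of_all _ fun ω => ?_)
  change ∫ y, G (_, y) ∂(M.stepKernel π (ω n)) = _
  rw [integral_stepKernel]
  simp only [mean, Finset.mul_sum]
  exact Finset.sum_congr rfl fun s' _ => by
    simp only [G, Preorder.frestrictLe_apply]
    ring

theorem integral_pair (M : ARRMDP S A) (π : Policy A) (s : S) (n : ℕ) (g : S → S → ℝ) :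
    ∫ ω, g (ω n) (ω (n + 1)) ∂(M.law π s) = ∫ ω, M.mean π g (ω n) ∂(M.law π s) := by
  simpa using M.integral_history_mul π s n (fun _ => 1) g

/-- Restricted to time `0`, the trajectory kernel is the identity, so only the Dirac initial law
remains. -/
theorem ae_apply_zero (M : ARRMDP S A) (π : Policy A) (s : S) :
    ∀ᵐ ω ∂(M.law π s), ω 0 = s := by
  have h : (M.law π s).map (Preorder.frestrictLe (π := fun _ => S) 0) =
      (Measure.dirac s).map (MeasurableEquiv.piUnique fun _ : Finset.Iic 0 => S).symm := by
    rw [law, Kernel.trajMeasure, Measure.map_comp _ _ (Preorder.measurable_frestrictLe 0),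
      Kernel.traj_map_frestrictLe, Kernel.partialTraj_self, Measure.id_comp]
  have h2 : ∀ᵐ x ∂((M.law π s).map (Preorder.frestrictLe (π := fun _ => S) 0)),
      x ⟨0, Finset.mem_Iic.2 le_rfl⟩ = s := by
    rw [h, ae_map_iff (MeasurableEquiv.measurable _).aemeasurable (Set.toFinite _).measurableSet,
      ae_dirac_iff (Set.toFinite _).measurableSet]
    rfl
  exact ae_of_ae_map (Preorder.measurable_frestrictLe 0).aemeasurable h2

theorem integral_apply_zero (M : ARRMDP S A) (π : Policy A) (s : S) (g : S → ℝ) :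
    ∫ ω, g (ω 0) ∂(M.law π s) = g s := by
  rw [integral_congr_ae ((M.ae_apply_zero π s).mono fun ω h => congrArg g h)]
  simp

/-- Almost surely, the chain makes only transitions of positive probability. -/
theorem ae_step_ne_zero (M : ARRMDP S A) (π : Policy A) (s : S) :
    ∀ᵐ ω ∂(M.law π s), ∀ t, M.P (ω t) (π (ω t)) (ω (t + 1)) ≠ 0 := by
  classical
  rw [ae_all_iff]
  intro t
  let g : S → S → ℝ := fun x y => if M.P x (π x) y = 0 then 1 else 0
  have h0 : ∫ ω, g (ω t) (ω (t + 1)) ∂(M.law π s) = 0 := by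
    rw [integral_pair]
    have : ∀ x, M.mean π g x = 0 := fun x => Finset.sum_eq_zero fun y _ => by
      by_cases h : M.P x (π x) y = 0 <;> simp [g, h]
    simp [this]
  rw [integral_eq_zero_iff_of_nonneg (fun ω => by simp only [g]; split_ifs <;> simp)
    (M.integrable_pair π s g t)] at h0
  filter_upwards [h0] with ω hω h
  simp [g, h] at hω

end MarkovProperty

/-! ### Summable expectations, and sequences controlled along the squares. -/

section Summation

variable {Ω : Type*} [MeasurableSpace Ω] {μ : Measure Ω}

/-- Tonelli. Finiteness of this integral yields both the almost sure summability and the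
integrability of the sum. -/
theorem tsum_lintegral_ne_top {f : ℕ → Ω → ℝ} (hf : ∀ n, Integrable (f n) μ)
    (h0 : ∀ n ω, 0 ≤ f n ω) (hs : Summable fun n => ∫ ω, f n ω ∂μ) :
    ∫⁻ ω, ∑' n, ENNReal.ofReal (f n ω) ∂μ ≠ ∞ := by
  rw [lintegral_tsum fun n => (hf n).aemeasurable.ennreal_ofReal]
  simp only [← ofReal_integral_eq_lintegral_ofReal (hf _) (ae_of_all _ (h0 _))]
  exact hs.tsum_ofReal_ne_top

theorem ae_summable_of_summable_integral {f : ℕ → Ω → ℝ} (hf : ∀ n, Integrable (f n) μ)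
    (h0 : ∀ n ω, 0 ≤ f n ω) (hs : Summable fun n => ∫ ω, f n ω ∂μ) :
    ∀ᵐ ω ∂μ, Summable fun n => f n ω := by
  filter_upwards [ae_lt_top' (AEMeasurable.tsum fun n => (hf n).aemeasurable.ennreal_ofReal)
    (tsum_lintegral_ne_top hf h0 hs)] with ω hω
  exact (ENNReal.summable_toReal hω.ne).congr fun n => ENNReal.toReal_ofReal (h0 n ω)

theorem integrable_tsum_of_nonneg {f : ℕ → Ω → ℝ} (hf : ∀ n, Integrable (f n) μ)
    (h0 : ∀ n ω, 0 ≤ f n ω) (hs : Summable fun n => ∫ ω, f n ω ∂μ) :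
    Integrable (fun ω => ∑' n, f n ω) μ := by
  refine (integrable_toReal_of_lintegral_ne_top
    (AEMeasurable.tsum fun n => (hf n).aemeasurable.ennreal_ofReal)
    (tsum_lintegral_ne_top hf h0 hs)).congr (ae_of_all _ fun ω => ?_)
  change (∑' n, ENNReal.ofReal (f n ω)).toReal = _
  rw [ENNReal.tsum_toReal_eq fun _ => ENNReal.ofReal_ne_top]
  exact tsum_congr fun n => ENNReal.toReal_ofReal (h0 n ω)

end Summation

/-- A sequence with bounded increments that is negligible along the squares is negligible. -/
theorem tendsto_div_of_tendsto_div_sq {u : ℕ → ℝ} {C : ℝ} (hC : 0 ≤ C)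
    (hu : ∀ m n, m ≤ n → |u n - u m| ≤ C * ((n : ℝ) - m))
    (h : Tendsto (fun n : ℕ => u (n * n) / ((n * n : ℕ) : ℝ)) atTop (𝓝 0)) :
    Tendsto (fun n : ℕ => u n / n) atTop (𝓝 0) := by
  have hsq : Tendsto Nat.sqrt atTop atTop :=
    tendsto_atTop_atTop.2 fun b => ⟨b * b, fun a ha => Nat.le_sqrt.2 ha⟩
  have hinv : Tendsto (fun n : ℕ => 2 * C / (n : ℝ)) atTop (𝓝 0) :=
    tendsto_const_div_atTop_nhds_zero_nat _
  have hb := (h.abs.comp hsq).add (hinv.comp hsq)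
  rw [abs_zero, zero_add] at hb
  refine squeeze_zero_norm' ?_ hb
  filter_upwards [eventually_ge_atTop 1] with n hn
  have hm1 : 1 ≤ n.sqrt := Nat.le_sqrt.2 (by simpa using hn)
  have hle : n.sqrt * n.sqrt ≤ n := Nat.sqrt_le n
  -- With `m = n.sqrt`, the distance from `n` to the square `m * m` is at most `2 * m`. The
  -- increment is thus at most `2 * C * m`, which divided by `m * m` tends to zero.
  have hup : n ≤ n.sqrt * n.sqrt + n.sqrt + n.sqrt := Nat.sqrt_le_add n
  simp only [Function.comp_apply]
  generalize n.sqrt = m at *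
  have hm : (0 : ℝ) < m := by exact_mod_cast hm1
  have hle' : ((m * m : ℕ) : ℝ) ≤ n := by exact_mod_cast hle
  have hup' : (n : ℝ) ≤ m * m + m + m := by exact_mod_cast hup
  have hmm : (0 : ℝ) < ((m * m : ℕ) : ℝ) := by push_cast; positivity
  have h1 : |u n| ≤ |u (m * m)| + 2 * C * m := by
    have h2 := hu _ _ hle
    have h3 : C * ((n : ℝ) - (m * m : ℕ)) ≤ C * (2 * m) :=
      mul_le_mul_of_nonneg_left (by push_cast; linarith) hC
    have h4 : |u n| ≤ |u n - u (m * m)| + |u (m * m)| := by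
      simpa using abs_add_le (u n - u (m * m)) (u (m * m))
    linarith
  rw [Real.norm_eq_abs, abs_div, Nat.abs_cast, abs_div, Nat.abs_cast]
  calc |u n| / n ≤ |u n| / ((m * m : ℕ) : ℝ) :=
        div_le_div_of_nonneg_left (abs_nonneg _) hmm hle'
    _ ≤ (|u (m * m)| + 2 * C * m) / ((m * m : ℕ) : ℝ) := by gcongr
    _ = |u (m * m)| / ((m * m : ℕ) : ℝ) + 2 * C / m := by
        rw [add_div]
        push_cast
        field_simp

/-! ### The strong law of large numbers for martingale differences. -/

section LawOfLargeNumbers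

variable {S : Type*} {A : S → Type*}

theorem sum_pair_congr (φ : S → S → ℝ) (T : ℕ) (ω ω' : ℕ → S) (h : ∀ k ≤ T, ω k = ω' k) :
    ∑ t ∈ Finset.range T, φ (ω t) (ω (t + 1)) = ∑ t ∈ Finset.range T, φ (ω' t) (ω' (t + 1)) :=
  Finset.sum_congr rfl fun t ht => by
    have := Finset.mem_range.1 ht
    rw [h t (by lia), h (t + 1) (by lia)]

/-- The trajectory that follows a finite history and then stays in its last state. -/
def extendHistory (n : ℕ) (h : ∀ _ : Finset.Iic n, S) : ℕ → S :=
  fun k => h ⟨min k n, Finset.mem_Iic.2 (min_le_right k n)⟩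

/-- Lets a function of the first `n` steps be treated as a function on the finite set of histories,
where measurability and boundedness are automatic. -/
theorem extendHistory_frestrictLe {n : ℕ} {G : (ℕ → S) → ℝ}
    (hG : ∀ ω ω' : ℕ → S, (∀ k ≤ n, ω k = ω' k) → G ω = G ω') (ω : ℕ → S) :
    G (extendHistory n (Preorder.frestrictLe (π := fun _ => S) n ω)) = G ω :=
  hG _ _ fun k hk => by simp [extendHistory, hk]

variable [Fintype S] [MeasurableSpace S] [MeasurableSingletonClass S]

theorem integrable_of_history (M : ARRMDP S A) (π : Policy A) (s : S) {n : ℕ} {G : (ℕ → S) → ℝ}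
    (hG : ∀ ω ω' : ℕ → S, (∀ k ≤ n, ω k = ω' k) → G ω = G ω') : Integrable G (M.law π s) := by
  simpa only [extendHistory_frestrictLe hG] using
    integrable_of_finite_range (μ := M.law π s) (Preorder.frestrictLe (π := fun _ => S) n)
      (fun h => G (extendHistory n h))
      (measurable_of_frestrictLe n fun h => G (extendHistory n h))

/-- The Markov property, for functions of the trajectory that depend on the first `n` steps. -/
theorem integral_mul_pair (M : ARRMDP S A) (π : Policy A) (s : S) {n : ℕ} {G : (ℕ → S) → ℝ}
    (hG : ∀ ω ω' : ℕ → S, (∀ k ≤ n, ω k = ω' k) → G ω = G ω') (g : S → S → ℝ) :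
    ∫ ω, G ω * g (ω n) (ω (n + 1)) ∂(M.law π s) = ∫ ω, G ω * M.mean π g (ω n) ∂(M.law π s) := by
  simpa only [extendHistory_frestrictLe hG] using
    M.integral_history_mul π s n (fun h => G (extendHistory n h)) g

/-- Martingale differences are orthogonal: by the Markov property the cross term with the past has
mean zero, so each step adds at most `C ^ 2`. -/
theorem integral_sq_sum_le (M : ARRMDP S A) (π : Policy A) (s : S) {φ : S → S → ℝ} {C : ℝ}
    (h0 : ∀ x, M.mean π φ x = 0) (hC : ∀ x y, |φ x y| ≤ C) (T : ℕ) :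
    ∫ ω, (∑ t ∈ Finset.range T, φ (ω t) (ω (t + 1))) ^ 2 ∂(M.law π s) ≤ C ^ 2 * T := by
  induction T with
  | zero => simp
  | succ T ih =>
    have hc := sum_pair_congr φ T
    have e : ∀ ω : ℕ → S, (∑ t ∈ Finset.range (T + 1), φ (ω t) (ω (t + 1))) ^ 2 =
        (∑ t ∈ Finset.range T, φ (ω t) (ω (t + 1))) ^ 2 +
          (2 * ∑ t ∈ Finset.range T, φ (ω t) (ω (t + 1))) * φ (ω T) (ω (T + 1)) +
          φ (ω T) (ω (T + 1)) ^ 2 := fun ω => by rw [Finset.sum_range_succ]; ring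
    have i1 : Integrable (fun ω : ℕ → S => (∑ t ∈ Finset.range T, φ (ω t) (ω (t + 1))) ^ 2)
        (M.law π s) := M.integrable_of_history π s (n := T) fun ω ω' h => by rw [hc ω ω' h]
    have i2 : Integrable (fun ω : ℕ → S =>
        (2 * ∑ t ∈ Finset.range T, φ (ω t) (ω (t + 1))) * φ (ω T) (ω (T + 1))) (M.law π s) :=
      M.integrable_of_history π s (n := T + 1) fun ω ω' h => by
        rw [hc ω ω' fun k hk => h k (by lia), h T (by lia), h (T + 1) le_rfl]
    have i3 := M.integrable_pair π s (fun x y => φ x y ^ 2) T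
    have z : ∫ ω, (2 * ∑ t ∈ Finset.range T, φ (ω t) (ω (t + 1))) * φ (ω T) (ω (T + 1))
        ∂(M.law π s) = 0 := by
      rw [M.integral_mul_pair π s (n := T)
        (G := fun ω => 2 * ∑ t ∈ Finset.range T, φ (ω t) (ω (t + 1)))
        (fun ω ω' h => by simp only [hc ω ω' h])]
      simp [h0]
    have b : ∫ ω, φ (ω T) (ω (T + 1)) ^ 2 ∂(M.law π s) ≤ C ^ 2 := by
      have := integral_mono i3 (integrable_const (μ := M.law π s) (C ^ 2)) fun ω => by
        simpa using sq_le_sq' (neg_le_of_abs_le (hC (ω T) (ω (T + 1)))) (le_of_abs_le (hC _ _))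
      simpa using this
    simp only [e]
    rw [integral_add (by exact i1.add i2) i3, integral_add i1 i2, z]
    push_cast
    linarith

/-- The strong law of large numbers for a function of the transitions with conditional mean `0`. -/
theorem ae_tendsto_avg_zero (M : ARRMDP S A) (π : Policy A) (s : S) {φ : S → S → ℝ}
    (h0 : ∀ x, M.mean π φ x = 0) :
    ∀ᵐ ω ∂(M.law π s), Tendsto
      (fun T : ℕ => (∑ t ∈ Finset.range T, φ (ω t) (ω (t + 1))) / T) atTop (𝓝 0) := by
  obtain ⟨C, hC'⟩ := (Set.finite_range fun x : S × S => |φ x.1 x.2|).bddAbove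
  have hC : ∀ x y, |φ x y| ≤ C := fun x y => hC' ⟨(x, y), rfl⟩
  have hC0 : 0 ≤ C := (abs_nonneg _).trans (hC s s)
  -- Along the squares the second moments of the averages are at most `C ^ 2 / n ^ 2`, hence
  -- summable, and no fourth moments are needed.
  let f : ℕ → (ℕ → S) → ℝ := fun n ω =>
    ((∑ t ∈ Finset.range (n * n), φ (ω t) (ω (t + 1))) / ((n * n : ℕ) : ℝ)) ^ 2
  have hf : ∀ n, Integrable (f n) (M.law π s) := fun n =>
    M.integrable_of_history π s (n := n * n) fun ω ω' h => by
      simp only [f, sum_pair_congr φ (n * n) ω ω' h]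
  have hs : Summable fun n => ∫ ω, f n ω ∂(M.law π s) := by
    refine Summable.of_nonneg_of_le (fun n => integral_nonneg fun ω => sq_nonneg _) (fun n => ?_)
      ((Real.summable_one_div_nat_pow.2 one_lt_two).mul_left (C ^ 2))
    simp only [f, div_pow, integral_div]
    rcases n.eq_zero_or_pos with rfl | hn
    · simp
    have hn' : (0 : ℝ) < n := by exact_mod_cast hn
    rw [div_le_iff₀ (by positivity)]
    refine (M.integral_sq_sum_le π s h0 hC (n * n)).trans (le_of_eq ?_)
    push_cast
    field_simp
  filter_upwards [ae_summable_of_summable_integral hf (fun n ω => sq_nonneg _) hs] with ω hω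
  refine tendsto_div_of_tendsto_div_sq hC0 (fun m n hmn => ?_) ?_
  · rw [← Finset.sum_Ico_eq_sub _ hmn]
    refine (Finset.abs_sum_le_sum_abs _ _).trans ((Finset.sum_le_sum fun t _ => hC _ _).trans ?_)
    rw [Finset.sum_const, Nat.card_Ico, nsmul_eq_mul, Nat.cast_sub hmn, mul_comm]
  · have := hω.tendsto_atTop_zero
    rw [tendsto_zero_iff_abs_tendsto_zero]
    simpa [f, Real.sqrt_sq_eq_abs, Function.comp_def] using
      (Real.continuous_sqrt.tendsto 0).comp this

end LawOfLargeNumbers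

/-! ### The maximum principle and the Poisson equation. -/

section Poisson

variable {S : Type*} {A : S → Type*}

/-- Under `π`, the transition from `x` to `y` has positive probability. -/
def Step (M : ARRMDP S A) (π : Policy A) (x y : S) : Prop := M.P x (π x) y ≠ 0

/-- Under `π`, the state `y` can be reached from `x`. -/
abbrev Reach (M : ARRMDP S A) (π : Policy A) : S → S → Prop := Relation.ReflTransGen (M.Step π)

theorem reach_of_steps (M : ARRMDP S A) (π : Policy A) {ω : ℕ → S}
    (h : ∀ t, M.P (ω t) (π (ω t)) (ω (t + 1)) ≠ 0) {m n : ℕ} (hmn : m ≤ n) :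
    M.Reach π (ω m) (ω n) := by
  induction n, hmn using Nat.le_induction with
  | base => exact .refl
  | succ n _ ih => exact ih.tail (h n)

variable [Fintype S]

theorem mean_le_of_step (M : ARRMDP S A) (π : Policy A) {g h : S → S → ℝ} {x : S}
    (H : ∀ y, M.Step π x y → g x y ≤ h x y) : M.mean π g x ≤ M.mean π h x :=
  Finset.sum_le_sum fun y _ => by
    by_cases hy : M.P x (π x) y = 0
    · simp [hy]
    · exact mul_le_mul_of_nonneg_left (H y hy) ENNReal.toReal_nonneg

/-- The maximum principle: a subharmonic function on the states reachable from `z` is maximal in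
`z` if all of them lead back to `z`. -/
theorem le_of_subharmonic (M : ARRMDP S A) (π : Policy A) {z : S}
    (hz : ∀ x, M.Reach π z x → M.Reach π x z) {f : S → ℝ}
    (hf : ∀ x, M.Reach π z x → f x ≤ M.mean π (fun _ y => f y) x) {x : S} (hx : M.Reach π z x) :
    f x ≤ f z := by
  classical
  obtain ⟨m, hm, hmax⟩ := Finset.exists_max_image
    (Finset.univ.filter fun x => M.Reach π z x) f ⟨z, by simp [Relation.ReflTransGen.refl]⟩
  simp only [Finset.mem_filter, Finset.mem_univ, true_and] at hm hmax
  -- A maximum spreads along steps: at a maximal point the mean of the nonnegative gaps `f m - f y`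
  -- is at most zero, so every gap of positive weight vanishes. As `m` leads back to `z`, the
  -- maximum is attained in `z`.
  have key : ∀ y, M.Reach π m y → f y = f m := by
    intro y hy
    induction hy with
    | refl => rfl
    | @tail b c hb hbc ih =>
      have hzb : M.Reach π z b := hm.trans hb
      have h1 : M.mean π (fun _ y => f m - f y) b ≤ 0 := by
        have h2 := hf b hzb
        rw [M.mean_sub π (fun _ _ => f m), M.mean_const π (fun _ => f m)]
        linarith
      have h3 : ∀ y ∈ Finset.univ, 0 ≤ (M.P b (π b) y).toReal * (f m - f y) := by
        intro y _
        by_cases hy : M.P b (π b) y = 0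
        · simp [hy]
        · exact mul_nonneg ENNReal.toReal_nonneg (sub_nonneg.2 (hmax y (hzb.tail hy)))
      have h4 := (Finset.sum_eq_zero_iff_of_nonneg h3).1
        (le_antisymm h1 (Finset.sum_nonneg h3)) c (Finset.mem_univ c)
      rcases mul_eq_zero.1 h4 with h5 | h5
      · exact absurd h5 (ENNReal.toReal_ne_zero.2 ⟨hbc, (M.P b (π b)).apply_ne_top c⟩)
      · linarith
  exact (hmax x hx).trans (key z (hz m hm)).ge

/-- Since `0 ≤ f z`, the equation makes `f` subharmonic, hence maximal in `z`. There the mean cannot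
exceed `f z`, so the equation forces `f z ≤ 0`. -/
theorem eq_zero_of_sub_mean_eq_neg (M : ARRMDP S A) (π : Policy A) {z : S}
    (hz : ∀ x, M.Reach π z x → M.Reach π x z) {f : S → ℝ}
    (hf : ∀ x, M.Reach π z x → f x - M.mean π (fun _ y => f y) x = -f z) (h0 : 0 ≤ f z) :
    f z = 0 := by
  have hle : ∀ x, M.Reach π z x → f x ≤ f z := fun x hx =>
    M.le_of_subharmonic π hz (fun y hy => by linarith [hf y hy]) hx
  have h1 : M.mean π (fun _ y => f y) z ≤ M.mean π (fun _ _ => f z) z :=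
    M.mean_le_of_step π fun y hy => hle y (.single hy)
  rw [M.mean_const π (fun _ => f z)] at h1
  linarith [hf z .refl]

/-- The Poisson equation is solvable on the states reachable from `z` if all of them lead back to
`z`. -/
theorem exists_poisson (M : ARRMDP S A) (π : Policy A) {z : S}
    (hz : ∀ x, M.Reach π z x → M.Reach π x z) (g : S → ℝ) :
    ∃ (f : S → ℝ) (c : ℝ), ∀ x, M.Reach π z x → f x = g x - c + M.mean π (fun _ y => f y) x := by
  classical
  -- The operator `f - E f` annihilates constants. Adding `f z` makes it injective, hence surjective
  -- in finite dimension, and `f z` becomes the constant `c`. Off the reachable states the identity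
  -- keeps it injective.
  let Φ : (S → ℝ) →ₗ[ℝ] (S → ℝ) :=
    { toFun := fun f x => if M.Reach π z x then f x - M.mean π (fun _ y => f y) x + f z else f x
      map_add' := fun f h => by
        ext x
        simp only [Pi.add_apply, M.mean_add π (fun _ y => f y)]
        split_ifs <;> ring
      map_smul' := fun c f => by
        ext x
        simp only [Pi.smul_apply, smul_eq_mul, M.mean_const_mul π c (fun _ y => f y),
          RingHom.id_apply]
        split_ifs <;> ring }
  have hΦ : ∀ f x, M.Reach π z x → Φ f x = f x - M.mean π (fun _ y => f y) x + f z :=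
    fun f x hx => if_pos hx
  have hinj : Function.Injective Φ := by
    rw [injective_iff_map_eq_zero]
    intro f hf
    have hf1 : ∀ x, M.Reach π z x → f x - M.mean π (fun _ y => f y) x = -f z := fun x hx => by
      have := hΦ f x hx
      rw [hf, Pi.zero_apply] at this
      linarith
    have hneg : ∀ x, M.mean π (fun _ y => -f y) x = -M.mean π (fun _ y => f y) x := fun x => by
      simpa using M.mean_const_mul π (-1) (fun _ y => f y) x
    have hfz : f z = 0 := by
      rcases le_total 0 (f z) with h | h
      · exact M.eq_zero_of_sub_mean_eq_neg π hz hf1 h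
      · refine neg_eq_zero.1 (M.eq_zero_of_sub_mean_eq_neg π hz (f := fun x => -f x)
          (fun x hx => ?_) (neg_nonneg.2 h))
        rw [hneg]
        linarith [hf1 x hx]
    ext x
    by_cases hx : M.Reach π z x
    · have h1 := M.le_of_subharmonic π hz (f := f) (fun y hy => by linarith [hf1 y hy]) hx
      have h2 := M.le_of_subharmonic π hz (f := fun x => -f x)
        (fun y hy => by rw [hneg]; linarith [hf1 y hy]) hx
      simp only [Pi.zero_apply]
      linarith
    · have h3 : Φ f x = f x := if_neg hx
      rw [← h3, hf]
  obtain ⟨f, hf⟩ := LinearMap.injective_iff_surjective.1 hinj g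
  refine ⟨f, f z, fun x hx => ?_⟩
  rw [← hf, hΦ f x hx]
  ring

end Poisson

/-! ### Recurrence, irreducibility and the ergodic theorem. -/

section Recurrence

variable {S : Type*} {A : S → Type*} [Fintype S] [MeasurableSpace S] [MeasurableSingletonClass S]

/-- A state that is reachable from `z` is reachable by a path that does not return to `z`. -/
theorem frequently_avoid (M : ARRMDP S A) (π : Policy A) {z x : S} (hx : M.Reach π z x) :
    ∃ n, ∃ᶠ ω in ae (M.law π z), ω n = x ∧ ∀ k, 1 ≤ k → k ≤ n → ω k ≠ z := by
  classical
  have hself : ∃ n, ∃ᶠ ω in ae (M.law π z), ω n = z ∧ ∀ k, 1 ≤ k → k ≤ n → ω k ≠ z :=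
    ⟨0, ((M.ae_apply_zero π z).mono fun ω h => ⟨h, fun k h1 h2 => by lia⟩).frequently⟩
  induction hx with
  | refl => exact hself
  | @tail b c hb hbc ih =>
    -- A path that comes back to `z` is replaced by the empty path.
    by_cases hc : c = z
    · rw [hc]
      exact hself
    obtain ⟨n, hn⟩ := ih
    refine ⟨n + 1, fun hnull => hn ?_⟩
    let G : (ℕ → S) → ℝ := fun ω => if ω n = b ∧ ∀ k, 1 ≤ k → k ≤ n → ω k ≠ z then 1 else 0
    have hG : ∀ ω ω' : ℕ → S, (∀ k ≤ n, ω k = ω' k) → G ω = G ω' := fun ω ω' h => by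
      have : (ω n = b ∧ ∀ k, 1 ≤ k → k ≤ n → ω k ≠ z) ↔
          (ω' n = b ∧ ∀ k, 1 ≤ k → k ≤ n → ω' k ≠ z) := by
        rw [h n le_rfl]
        exact and_congr_right fun _ => forall_congr' fun k => forall_congr' fun _ =>
          forall_congr' fun hk => by rw [h k hk]
      simp only [G]
      split_ifs with h1 h2 h2
      · rfl
      · exact absurd (this.1 h1) h2
      · exact absurd (this.2 h2) h1
      · rfl
    -- If the extended path had probability zero, this identity would read `0 = E G * P(b, c)`; as
    -- `P(b, c)` is nonzero, the path to `b` would have probability zero too.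
    have e := M.integral_mul_pair π z hG fun _ y => if y = c then 1 else 0
    have e1 : ∫ ω, G ω * (if ω (n + 1) = c then (1 : ℝ) else 0) ∂(M.law π z) = 0 := by
      refine integral_eq_zero_of_ae ?_
      filter_upwards [hnull] with ω hω
      simp only [Pi.zero_apply, mul_eq_zero]
      by_contra! hne
      simp only [G, ne_eq, ite_eq_right_iff, one_ne_zero, imp_false, not_not] at hne
      refine hω ⟨hne.2, fun k h1 h2 => ?_⟩
      rcases Nat.le_succ_iff.1 h2 with h3 | h3
      · exact hne.1.2 k h1 h3
      · rw [h3, Nat.succ_eq_add_one, hne.2]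
        exact hc
    have e2 : ∀ ω : ℕ → S, G ω * M.mean π (fun _ y => if y = c then 1 else 0) (ω n) =
        G ω * (M.P b (π b) c).toReal := fun ω => by
      by_cases h : ω n = b ∧ ∀ k, 1 ≤ k → k ≤ n → ω k ≠ z
      · rw [h.1]
        simp [mean]
      · simp only [G, if_neg h, zero_mul]
    rw [e1] at e
    simp only [e2, integral_mul_const] at e
    have hne : (M.P b (π b) c).toReal ≠ 0 :=
      ENNReal.toReal_ne_zero.2 ⟨hbc, (M.P b (π b)).apply_ne_top c⟩
    have e3 := (mul_eq_zero.1 e.symm).resolve_right hne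
    rw [integral_eq_zero_iff_of_nonneg (fun ω => by simp only [G]; split_ifs <;> simp)
      (M.integrable_of_history π z hG)] at e3
    filter_upwards [e3] with ω hω h
    exact one_ne_zero ((if_pos h : G ω = 1).symm.trans hω)

/-- Every state that can be reached from a recurrent state leads back to it. -/
theorem reach_symm_of_recurrent (M : ARRMDP S A) (π : Policy A) {z x : S}
    (hrec : ∀ᵐ ω ∂(M.law π z), ∃ n, 1 ≤ n ∧ ω n = z) (hx : M.Reach π z x) : M.Reach π x z := by
  obtain ⟨n, hn⟩ := M.frequently_avoid π hx
  -- One trajectory has all three properties: it is in `x` at time `n` without having returned to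
  -- `z`, its steps are possible, and it does return. The return at time `m` must therefore come
  -- after `n`.
  obtain ⟨ω, ⟨⟨h1, h2⟩, h3⟩, m, hm, hmz⟩ :=
    ((hn.and_eventually (M.ae_step_ne_zero π z)).and_eventually hrec).exists
  rw [← h1, ← hmz]
  exact M.reach_of_steps π h3 (le_of_not_ge fun hmn => h2 m hm hmn hmz)

theorem ae_reach (M : ARRMDP S A) (π : Policy A) (z : S) :
    ∀ᵐ ω ∂(M.law π z), ∀ t, M.Reach π z (ω t) := by
  filter_upwards [M.ae_apply_zero π z, M.ae_step_ne_zero π z] with ω h0 h t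
  rw [← h0]
  exact M.reach_of_steps π h t.zero_le

/-- The ergodic theorem: the averages of a function of the transitions converge almost surely to
the constant of a Poisson equation. -/
theorem ae_tendsto_avg (M : ARRMDP S A) (π : Policy A) {z : S} {g : S → S → ℝ} {f : S → ℝ} {c : ℝ}
    (hf : ∀ x, M.Reach π z x → f x = M.mean π g x - c + M.mean π (fun _ y => f y) x) :
    ∀ᵐ ω ∂(M.law π z), Tendsto
      (fun T : ℕ => (∑ t ∈ Finset.range T, g (ω t) (ω (t + 1))) / T) atTop (𝓝 c) := by
  classical
  -- The Poisson equation says exactly that this has conditional mean zero. Off the reachable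
  -- states, where the equation may fail, it is set to zero; the chain never goes there.
  let φ : S → S → ℝ := fun x y => if M.Reach π z x then g x y - c - f x + f y else 0
  have hφ : ∀ x, M.mean π φ x = 0 := by
    intro x
    by_cases hx : M.Reach π z x
    · have : M.mean π φ x = M.mean π (fun x y => g x y - c - f x + f y) x :=
        Finset.sum_congr rfl fun y _ => by simp only [φ, if_pos hx]
      rw [this, M.mean_add π (fun x y => g x y - c - f x) (fun _ y => f y),
        M.mean_sub π (fun x y => g x y - c) (fun x _ => f x), M.mean_sub π g (fun _ _ => c),
        M.mean_const π f, M.mean_const π (fun _ => c)]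
      linarith [hf x hx]
    · exact Finset.sum_eq_zero fun y _ => by simp only [φ, if_neg hx, mul_zero]
  obtain ⟨B, hB'⟩ := (Set.finite_range fun x => |f x|).bddAbove
  have hB : ∀ x, |f x| ≤ B := fun x => hB' ⟨x, rfl⟩
  filter_upwards [M.ae_tendsto_avg_zero π z hφ, M.ae_reach π z] with ω h1 h2
  have h3 : Tendsto (fun T : ℕ => (f (ω 0) - f (ω T)) / T) atTop (𝓝 0) := by
    refine squeeze_zero_norm (fun T => ?_) (tendsto_const_div_atTop_nhds_zero_nat (2 * B))
    rw [norm_div, RCLike.norm_natCast, Real.norm_eq_abs]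
    gcongr
    linarith [abs_sub (f (ω 0)) (f (ω T)), hB (ω 0), hB (ω T)]
  have h4 := (h1.add h3).add_const c
  simp only [add_zero, zero_add] at h4
  refine h4.congr' ?_
  filter_upwards [eventually_ge_atTop 1] with T hT
  have hT' : (T : ℝ) ≠ 0 := by positivity
  have h5 : ∑ t ∈ Finset.range T, φ (ω t) (ω (t + 1)) =
      ∑ t ∈ Finset.range T, g (ω t) (ω (t + 1)) - T * c - (f (ω 0) - f (ω T)) := by
    rw [← Finset.sum_range_sub' (fun t => f (ω t)), eq_comm, sub_sub, ← nsmul_eq_mul,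
      ← Finset.card_range T, ← Finset.sum_const, Finset.card_range, ← Finset.sum_add_distrib,
      ← Finset.sum_sub_distrib]
    exact Finset.sum_congr rfl fun t _ => by simp only [φ, if_pos (h2 t)]; ring
  rw [h5]
  field_simp
  ring

end Recurrence

/-! ### The process with termination: transitions, survival and lifetime. -/

section Termination

variable {S : Type*} {A : S → Type*}

theorem pt_P_true (M : ARRMDP S A) (H : ℝ) (x : S) (a : A x) (y : S) (b : Bool) :
    (M.pt H).P (x, true) a (y, b) = M.P x a y * coin H (M.D x a y) b := by
  classical
  change ((M.P x a).bind fun j => (coin H (M.D x a j)).map (Prod.mk j)) (y, b) = _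
  rw [PMF.bind_apply, tsum_eq_single y]
  · congr 1
    rw [PMF.map_apply, tsum_eq_single b] <;> simp +contextual [eq_comm]
  · intro j hj
    rw [PMF.map_apply, ENNReal.tsum_eq_zero.2, mul_zero]
    intro b'
    simp [hj.symm]

theorem pt_P_false (M : ARRMDP S A) (H : ℝ) (x : S) (a : A x) :
    (M.pt H).P (x, false) a = PMF.pure (x, false) := rfl

/-- The continuation probability of the transition from `x` to `y`, as a real number. -/
def cont (M : ARRMDP S A) (H : ℝ) (π : Policy A) (x y : S) : ℝ := contProb H (M.D x (π x) y)

theorem cont_le_one (M : ARRMDP S A) (H : ℝ) (π : Policy A) (x y : S) : M.cont H π x y ≤ 1 :=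
  contProb_le_one _ _

theorem coin_true_toReal (H : ℝ) (d : ℝ≥0) : (coin H d true).toReal = contProb H d := by
  simp [coin]

theorem coin_false_toReal (H : ℝ) (d : ℝ≥0) : (coin H d false).toReal = 1 - contProb H d := by
  have h : (contProb H d : ℝ≥0∞) ≤ 1 := by exact_mod_cast contProb_le_one H d
  simp [coin, ENNReal.toReal_sub_of_le h]

/-- The function on the states of the process with termination that is `ψ` before termination and
`0` in the terminal state. -/
def alive (ψ : S → ℝ) (x : S × Bool) : ℝ := if x.2 then ψ x.1 else 0

variable [Fintype S]

theorem pt_mean_true (M : ARRMDP S A) (H : ℝ) (π : Policy A) (g : S × Bool → S × Bool → ℝ)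
    (x : S) : (M.pt H).mean π.lift g (x, true) =
      M.mean π (fun x y => M.cont H π x y * g (x, true) (y, true) +
        (1 - M.cont H π x y) * g (x, true) (y, false)) x := by
  simp only [mean, Fintype.sum_prod_type, Fintype.sum_bool, Policy.lift, pt_P_true,
    ENNReal.toReal_mul, coin_true_toReal, coin_false_toReal, cont]
  exact Finset.sum_congr rfl fun y _ => by ring

theorem pt_mean_false (M : ARRMDP S A) (H : ℝ) (π : Policy A) (g : S × Bool → S × Bool → ℝ)
    (x : S) : (M.pt H).mean π.lift g (x, false) = g (x, false) (x, false) := by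
  classical
  simp only [mean, Policy.lift, pt_P_false, PMF.pure_apply]
  rw [Finset.sum_eq_single (x, false)]
  · simp
  · intro y _ hy
    simp [hy]
  · simp

/-- The mean of `h` in the next state, discounted by the continuation probability. -/
def discount (M : ARRMDP S A) (H : ℝ) (π : Policy A) (h : S → ℝ) (x : S) : ℝ :=
  M.mean π (fun x y => M.cont H π x y * h y) x

theorem pt_mean_alive (M : ARRMDP S A) (H : ℝ) (π : Policy A) (h : S → ℝ) (x : S × Bool) :
    (M.pt H).mean π.lift (fun _ y => alive h y) x = alive (M.discount H π h) x := by
  obtain ⟨x, b⟩ := x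
  cases b
  · rw [pt_mean_false]
    rfl
  · rw [pt_mean_true]
    simp [alive, discount]

theorem pt_mean_reward (M : ARRMDP S A) (H : ℝ) (π : Policy A) (x : S × Bool) :
    (M.pt H).mean π.lift (fun x y => (M.pt H).R x (π.lift x) y) x =
      alive (M.mean π fun x y => M.R x (π x) y) x := by
  obtain ⟨x, b⟩ := x
  cases b
  · rw [pt_mean_false]
    rfl
  · rw [pt_mean_true]
    simp only [pt, alive, Policy.lift, if_true]
    exact Finset.sum_congr rfl fun y _ => by ring

/-- Rewards are dominated by a multiple of the survival indicator, so a finite expected lifetime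
justifies every exchange of sum and expectation. -/
theorem exists_abs_pt_reward_le (M : ARRMDP S A) (H : ℝ) (π : Policy A) :
    ∃ B, ∀ t ω, |(M.pt H).reward π.lift t ω| ≤ B * alive (fun _ => 1) (ω t) := by
  obtain ⟨B, hB'⟩ := (Set.finite_range fun x : S × S => |M.R x.1 (π x.1) x.2|).bddAbove
  refine ⟨B, fun t ω => ?_⟩
  cases hb : (ω t).2
  · simp [reward, pt, alive, hb]
  · simpa [reward, pt, alive, hb, Policy.lift] using hB' ⟨((ω t).1, (ω (t + 1)).1), rfl⟩

variable [MeasurableSpace S] [MeasurableSingletonClass S]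

instance (M : ARRMDP S A) (z : S) (H : ℝ) (π : Policy A) :
    IsProbabilityMeasure (M.ptLaw z H π) := by
  unfold ptLaw
  infer_instance

/-- Almost surely, the process with termination makes transitions of the original process until
it terminates, and then stays where it is. -/
theorem ae_pt_step (M : ARRMDP S A) (z : S) (H : ℝ) (π : Policy A) :
    ∀ᵐ ω ∂(M.ptLaw z H π), ∀ t, ((ω t).2 = false → ω (t + 1) = ω t) ∧
      ((ω t).2 = true → M.Step π (ω t).1 (ω (t + 1)).1) := by
  filter_upwards [(M.pt H).ae_step_ne_zero π.lift (z, true)] with ω hω t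
  have h := hω t
  generalize ω (t + 1) = y at *
  generalize ω t = x at *
  obtain ⟨x, b⟩ := x
  obtain ⟨y, b'⟩ := y
  cases b
  · refine ⟨fun _ => ?_, fun h => by simp at h⟩
    rw [pt_P_false] at h
    by_contra hne
    exact h (PMF.pure_apply_of_ne _ _ hne)
  · refine ⟨fun h => by simp at h, fun _ h0 => h ?_⟩
    rw [pt_P_true]
    exact mul_eq_zero_of_left h0 _

theorem ae_pt_reach (M : ARRMDP S A) (z : S) (H : ℝ) (π : Policy A) :
    ∀ᵐ ω ∂(M.ptLaw z H π), ∀ t, M.Reach π z (ω t).1 := by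
  filter_upwards [M.ae_pt_step z H π, (M.pt H).ae_apply_zero π.lift (z, true)] with ω hω h0 t
  induction t with
  | zero => rw [h0]
  | succ t ih =>
    cases hb : (ω t).2
    · rwa [(hω t).1 hb]
    · exact ih.tail ((hω t).2 hb)

theorem integrable_alive (M : ARRMDP S A) (z : S) (H : ℝ) (π : Policy A) (ψ : S → ℝ) (t : ℕ) :
    Integrable (fun ω => alive ψ (ω t)) (M.ptLaw z H π) :=
  (M.pt H).integrable_coord π.lift (z, true) (alive ψ) t

/-- The expectation of `ψ` at time `t`, on the event that the process has not yet terminated. -/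
def aliveMean (M : ARRMDP S A) (z : S) (H : ℝ) (π : Policy A) (ψ : S → ℝ) (t : ℕ) : ℝ :=
  ∫ ω, alive ψ (ω t) ∂(M.ptLaw z H π)

theorem aliveMean_zero (M : ARRMDP S A) (z : S) (H : ℝ) (π : Policy A) (ψ : S → ℝ) :
    M.aliveMean z H π ψ 0 = ψ z := by
  rw [aliveMean, ptLaw, integral_apply_zero]
  rfl

/-- The Markov property: terminal states carry the value zero, so averaging over the last coin
leaves only the continuation factor. -/
theorem aliveMean_succ (M : ARRMDP S A) (z : S) (H : ℝ) (π : Policy A) (h : S → ℝ) (t : ℕ) :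
    M.aliveMean z H π h (t + 1) = M.aliveMean z H π (M.discount H π h) t := by
  simp only [aliveMean, ptLaw]
  rw [(M.pt H).integral_pair π.lift (z, true) t (fun _ y => alive h y)]
  simp only [pt_mean_alive]

theorem aliveMean_add (M : ARRMDP S A) (z : S) (H : ℝ) (π : Policy A) (ψ χ : S → ℝ) (t : ℕ) :
    M.aliveMean z H π (fun x => ψ x + χ x) t =
      M.aliveMean z H π ψ t + M.aliveMean z H π χ t := by
  simp only [aliveMean]
  rw [← integral_add (M.integrable_alive z H π ψ t) (M.integrable_alive z H π χ t)]
  congr with ω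
  simp only [alive]
  split_ifs <;> simp

theorem aliveMean_const_mul (M : ARRMDP S A) (z : S) (H : ℝ) (π : Policy A) (c : ℝ) (ψ : S → ℝ)
    (t : ℕ) : M.aliveMean z H π (fun x => c * ψ x) t = c * M.aliveMean z H π ψ t := by
  simp only [aliveMean]
  rw [← integral_const_mul]
  congr with ω
  simp only [alive]
  split_ifs <;> simp

theorem aliveMean_mono (M : ARRMDP S A) (z : S) (H : ℝ) (π : Policy A) {ψ χ : S → ℝ}
    (h : ∀ x, M.Reach π z x → ψ x ≤ χ x) (t : ℕ) :
    M.aliveMean z H π ψ t ≤ M.aliveMean z H π χ t := by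
  refine integral_mono_ae (M.integrable_alive z H π ψ t) (M.integrable_alive z H π χ t) ?_
  filter_upwards [M.ae_pt_reach z H π] with ω hω
  simp only [alive]
  split_ifs
  · exact h _ (hω t)
  · exact le_rfl

theorem aliveMean_nonneg (M : ARRMDP S A) (z : S) (H : ℝ) (π : Policy A) {ψ : S → ℝ}
    (h : ∀ x, 0 ≤ ψ x) (t : ℕ) : 0 ≤ M.aliveMean z H π ψ t :=
  integral_nonneg fun ω => by
    simp only [alive, Pi.zero_apply]
    split_ifs
    · exact h _
    · exact le_rfl

/-- A nonnegative function whose discounted mean decreases by a fixed amount bounds the expected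
lifetime of the process. -/
theorem summable_aliveMean_one (M : ARRMDP S A) (z : S) (H : ℝ) (π : Policy A) {h : S → ℝ} {κ : ℝ}
    (hκ : 0 < κ) (h0 : ∀ x, 0 ≤ h x)
    (hh : ∀ x, M.Reach π z x → κ + M.discount H π h x ≤ h x) :
    Summable (M.aliveMean z H π fun _ => 1) := by
  refine summable_of_sum_range_le (c := h z / κ) (fun t => M.aliveMean_nonneg z H π (by simp) t)
    fun T => ?_
  rw [le_div_iff₀ hκ]
  -- Lyapunov argument: each step survived costs `κ` out of the initial budget `h z`, and the
  -- remaining budget stays nonnegative.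
  have key : (∑ t ∈ Finset.range T, M.aliveMean z H π (fun _ => 1) t) * κ +
      M.aliveMean z H π h T ≤ h z := by
    induction T with
    | zero => simp [aliveMean_zero]
    | succ T ih =>
      have h1 := M.aliveMean_mono z H π hh T
      have h2 := M.aliveMean_add z H π (fun _ => κ) (M.discount H π h) T
      have h3 := M.aliveMean_const_mul z H π κ (fun _ => 1) T
      simp only [mul_one] at h3
      rw [Finset.sum_range_succ, aliveMean_succ]
      linarith
  linarith [M.aliveMean_nonneg z H π h0 T]

theorem summable_aliveMean (M : ARRMDP S A) {z : S} {H : ℝ} {π : Policy A}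
    (hs : Summable (M.aliveMean z H π fun _ => 1)) (ψ : S → ℝ) :
    Summable (M.aliveMean z H π ψ) := by
  obtain ⟨B, hB'⟩ := (Set.finite_range fun x => |ψ x|).bddAbove
  have hB : ∀ x, |ψ x| ≤ B := fun x => hB' ⟨x, rfl⟩
  refine Summable.of_norm_bounded (hs.mul_left B) fun t => ?_
  rw [Real.norm_eq_abs, abs_le, ← neg_mul, ← aliveMean_const_mul, ← aliveMean_const_mul]
  exact ⟨M.aliveMean_mono z H π (fun x _ => by linarith [neg_le_of_abs_le (hB x)]) t,
    M.aliveMean_mono z H π (fun x _ => by linarith [le_of_abs_le (hB x)]) t⟩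

/-- The expectation of the sum of `ψ` over the states visited before termination. -/
def green (M : ARRMDP S A) (z : S) (H : ℝ) (π : Policy A) (ψ : S → ℝ) : ℝ :=
  ∑' t, M.aliveMean z H π ψ t

/-! ### Expected totals up to termination. -/

section Green

variable {M : ARRMDP S A} {z : S} {H : ℝ} {π : Policy A}

theorem green_add (hs : Summable (M.aliveMean z H π fun _ => 1)) (ψ χ : S → ℝ) :
    M.green z H π (fun x => ψ x + χ x) = M.green z H π ψ + M.green z H π χ := by
  simp only [green, aliveMean_add]
  exact (M.summable_aliveMean hs ψ).tsum_add (M.summable_aliveMean hs χ)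

theorem green_const_mul (c : ℝ) (ψ : S → ℝ) :
    M.green z H π (fun x => c * ψ x) = c * M.green z H π ψ := by
  simp only [green, aliveMean_const_mul, tsum_mul_left]

theorem green_sub (hs : Summable (M.aliveMean z H π fun _ => 1)) (ψ χ : S → ℝ) :
    M.green z H π (fun x => ψ x - χ x) = M.green z H π ψ - M.green z H π χ := by
  have h := green_add hs ψ fun x => -1 * χ x
  rw [green_const_mul] at h
  simpa [sub_eq_add_neg] using h

theorem green_mono (hs : Summable (M.aliveMean z H π fun _ => 1)) {ψ χ : S → ℝ}
    (h : ∀ x, M.Reach π z x → ψ x ≤ χ x) : M.green z H π ψ ≤ M.green z H π χ :=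
  (M.summable_aliveMean hs ψ).tsum_le_tsum (M.aliveMean_mono z H π h) (M.summable_aliveMean hs χ)

theorem green_congr (hs : Summable (M.aliveMean z H π fun _ => 1)) {ψ χ : S → ℝ}
    (h : ∀ x, M.Reach π z x → ψ x = χ x) : M.green z H π ψ = M.green z H π χ :=
  le_antisymm (green_mono hs fun x hx => (h x hx).le) (green_mono hs fun x hx => (h x hx).ge)

theorem abs_green_le (hs : Summable (M.aliveMean z H π fun _ => 1)) {ψ χ : S → ℝ}
    (h : ∀ x, |ψ x| ≤ χ x) : |M.green z H π ψ| ≤ M.green z H π χ := by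
  refine abs_le.2 ⟨?_, green_mono hs fun x _ => le_of_abs_le (h x)⟩
  have h1 : M.green z H π (fun x => -1 * χ x) ≤ M.green z H π ψ :=
    green_mono hs fun x _ => by linarith [neg_le_of_abs_le (h x)]
  rw [green_const_mul] at h1
  linarith

/-- Telescoping: by `aliveMean_succ` the discounted term at time `t` is the undiscounted one at time
`t + 1`. -/
theorem green_sub_discount (hs : Summable (M.aliveMean z H π fun _ => 1)) (h : S → ℝ) :
    M.green z H π (fun x => h x - M.discount H π h x) = h z := by
  rw [green_sub hs]
  simp only [green]
  rw [(M.summable_aliveMean hs h).tsum_eq_zero_add, aliveMean_zero]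
  simp only [aliveMean_succ]
  ring

/-- The expected number of terminations is one. -/
theorem green_mean_one_sub_cont (hs : Summable (M.aliveMean z H π fun _ => 1)) :
    M.green z H π (M.mean π fun x y => 1 - M.cont H π x y) = 1 := by
  have h := green_sub_discount hs fun _ => 1
  refine Eq.trans (congrArg _ (funext fun x => ?_)) h
  rw [M.mean_sub π (fun _ _ => 1), M.mean_const π fun _ => 1, discount]
  simp only [mul_one]

/-- The process terminates almost surely if its expected lifetime is finite. -/
theorem ae_exists_term (hs : Summable (M.aliveMean z H π fun _ => 1)) :
    ∀ᵐ ω ∂(M.ptLaw z H π), ∃ t, 1 ≤ t ∧ (ω t).2 = false := by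
  filter_upwards [ae_summable_of_summable_integral (M.integrable_alive z H π fun _ => 1)
    (fun t ω => by simp only [alive]; split_ifs <;> simp) hs] with ω hω
  -- The survival indicators take only the values `0` and `1`, so once below one they are zero.
  have h := hω.tendsto_atTop_zero.eventually (gt_mem_nhds (one_pos (α := ℝ)))
  obtain ⟨t, ht, h1⟩ := (h.and (eventually_ge_atTop 1)).exists
  refine ⟨t, h1, ?_⟩
  by_contra hne
  rw [Bool.not_eq_false] at hne
  simp [alive, hne] at ht

theorem ae_ptTotal_eq_tsum (hs : Summable (M.aliveMean z H π fun _ => 1)) :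
    M.ptTotal H π =ᵐ[M.ptLaw z H π]
      fun ω => (1 / H) * ∑' t, (M.pt H).reward π.lift t ω := by
  filter_upwards [ae_exists_term hs, M.ae_pt_step z H π] with ω hex hω
  rw [ptTotal, tsum_eq_sum (s := Finset.range (term ω))]
  intro t ht
  have hτ : (ω (term ω)).2 = false := (Nat.sInf_mem hex).2
  have hdead : ∀ n, term ω ≤ n → (ω n).2 = false := fun n hn => by
    induction n, hn using Nat.le_induction with
    | base => exact hτ
    | succ n _ ih => rw [(hω n).1 ih, ih]
  have := hdead t (by simpa using ht)
  simp [reward, pt, this]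

theorem integrable_pt_reward (M : ARRMDP S A) (z : S) (H : ℝ) (π : Policy A) (t : ℕ) :
    Integrable ((M.pt H).reward π.lift t) (M.ptLaw z H π) :=
  (M.pt H).integrable_pair π.lift (z, true) (fun x y => (M.pt H).R x (π.lift x) y) t

theorem integrable_ptTotal (hs : Summable (M.aliveMean z H π fun _ => 1)) :
    Integrable (M.ptTotal H π) (M.ptLaw z H π) := by
  refine Integrable.congr (Integrable.const_mul ?_ _) (ae_ptTotal_eq_tsum hs).symm
  obtain ⟨B, hB⟩ := exists_abs_pt_reward_le M H π
  have h0 : ∀ (t : ℕ) (ω : ℕ → S × Bool), 0 ≤ alive (fun _ => (1 : ℝ)) (ω t) :=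
    fun t ω => by simp only [alive]; split_ifs <;> simp
  refine ((integrable_tsum_of_nonneg (M.integrable_alive z H π fun _ => 1) h0 hs).const_mul B).mono'
    ((AEMeasurable.tsum fun t => (M.integrable_pt_reward z H π t).aemeasurable)
      |>.aestronglyMeasurable) ?_
  filter_upwards [ae_summable_of_summable_integral (M.integrable_alive z H π fun _ => 1) h0 hs]
    with ω hω
  rw [← tsum_mul_left]
  exact tsum_of_norm_bounded (hω.mul_left B).hasSum fun t => hB t ω

theorem revPT_eq_green (hs : Summable (M.aliveMean z H π fun _ => 1)) :
    M.revPT z H π = (1 / H) * M.green z H π (M.mean π fun x y => M.R x (π x) y) := by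
  obtain ⟨B, hB⟩ := exists_abs_pt_reward_le M H π
  rw [revPT, integral_congr_ae (ae_ptTotal_eq_tsum hs), integral_const_mul,
    ← integral_tsum_of_summable_integral_norm (M.integrable_pt_reward z H π), green]
  · congr 2 with t
    refine ((M.pt H).integral_pair π.lift (z, true) t
      fun x y => (M.pt H).R x (π.lift x) y).trans ?_
    simp only [pt_mean_reward]
    rfl
  · refine Summable.of_nonneg_of_le (fun t => integral_nonneg fun ω => norm_nonneg _) (fun t => ?_)
      (hs.mul_left B)
    rw [aliveMean, ← integral_const_mul]
    exact integral_mono (M.integrable_pt_reward z H π t).norm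
      ((M.integrable_alive z H π (fun _ => 1) t).const_mul B) fun ω => hB t ω

end Green

end Termination

/-! ### Asymptotics for large horizon. -/

section Asymptotics

/-- The derivative of `(1 - u) ^ d` at `u = 0`, taken along `u = 1 / H`. -/
theorem tendsto_mul_one_sub_rpow (d : ℝ) :
    Tendsto (fun H : ℝ => H * (1 - (1 - 1 / H) ^ d)) atTop (𝓝 d) := by
  have h1 : HasDerivAt (fun u : ℝ => (1 - u) ^ d) (-d) 0 := by
    have := ((hasDerivAt_id (0 : ℝ)).const_sub 1).rpow_const (p := d) (Or.inl (by simp))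
    simpa using this
  have h2 := (h1.tendsto_slope_zero_right.comp tendsto_inv_atTop_nhdsGT_zero).neg
  rw [neg_neg] at h2
  refine h2.congr fun H => ?_
  simp
  ring

/-- For large `H`, the probability to stop is close to `d / H`, with small relative error. -/
theorem eventually_abs_sub_le (d : ℝ≥0) {η : ℝ} (hη : 0 < η) :
    ∀ᶠ H : ℝ in atTop, |(d : ℝ) / H - (1 - contProb H d)| ≤ η * (1 - contProb H d) := by
  rcases eq_or_ne d 0 with rfl | hd
  · simp [contProb]
  have hd' : (0 : ℝ) < d := by exact_mod_cast pos_iff_ne_zero.2 hd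
  have h1 := tendsto_mul_one_sub_rpow d
  have h2 : Tendsto (fun H : ℝ => (d : ℝ) / (H * (1 - (1 - 1 / H) ^ (d : ℝ)))) atTop (𝓝 1) := by
    have h := (tendsto_const_nhds (x := (d : ℝ))).div h1 hd'.ne'
    rw [div_self hd'.ne'] at h
    exact h
  filter_upwards [eventually_ge_atTop 1, h1.eventually (lt_mem_nhds hd'),
    h2.eventually (Metric.closedBall_mem_nhds 1 hη)] with H hH hq hc
  rw [coe_contProb hH]
  have hH0 : 0 < H := by linarith
  rw [Real.dist_eq] at hc
  have hp : 0 < 1 - (1 - 1 / H) ^ (d : ℝ) := pos_of_mul_pos_right hq hH0.le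
  generalize 1 - (1 - 1 / H) ^ (d : ℝ) = p at *
  have e : (d : ℝ) / H - p = (d / (H * p) - 1) * p := by
    field_simp
  rw [e, abs_mul, abs_of_pos hp]
  exact mul_le_mul_of_nonneg_right hc hp.le

theorem contProb_lt_one {H : ℝ} (hH : 1 < H) {d : ℝ≥0} (hd : d ≠ 0) : (contProb H d : ℝ) < 1 := by
  have h1 : 0 < 1 / H := by positivity
  have h2 : 1 / H < 1 := by rw [div_lt_one (by linarith)]; exact hH
  rw [coe_contProb hH.le]
  exact Real.rpow_lt_one (by linarith) (by linarith) (by exact_mod_cast pos_iff_ne_zero.2 hd)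

variable {S : Type*} {A : S → Type*} [Fintype S]

theorem exists_abs_le (f : S → ℝ) : ∃ B, ∀ x, |f x| ≤ B := by
  obtain ⟨B, hB⟩ := (Set.finite_range fun x => |f x|).bddAbove
  exact ⟨B, fun x => hB ⟨x, rfl⟩⟩

/-- There are finitely many transitions, and zero stopping probability occurs only with zero
difficulty. The constant may depend on `H`, as it only serves to show that the lifetime is finite.
-/
theorem exists_difficulty_le (M : ARRMDP S A) (π : Policy A) {H : ℝ} (hH : 1 < H) :
    ∃ C : ℝ, ∀ x y, (M.D x (π x) y : ℝ) ≤ C * (1 - M.cont H π x y) := by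
  obtain ⟨C, hC⟩ := exists_abs_le fun x : S × S =>
    (M.D x.1 (π x.1) x.2 : ℝ) / (1 - M.cont H π x.1 x.2)
  refine ⟨C, fun x y => ?_⟩
  rcases eq_or_ne (M.D x (π x) y) 0 with h0 | h0
  · simp [cont, h0, contProb]
  · have h1 : 0 < 1 - M.cont H π x y := sub_pos.2 (contProb_lt_one hH h0)
    exact (div_le_iff₀ h1).1 (le_of_abs_le (hC (x, y)))

variable [MeasurableSpace S] [MeasurableSingletonClass S]

/-- If the average difficulty is positive, the process with termination has a finite expected
lifetime. -/
theorem summable_aliveMean_one_of_poisson (M : ARRMDP S A) (π : Policy A) {z : S} {f : S → ℝ}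
    {c : ℝ} (hc : 0 < c)
    (hf : ∀ x, M.Reach π z x →
      f x = M.mean π (fun x y => (M.D x (π x) y : ℝ)) x - c + M.mean π (fun _ y => f y) x)
    {H : ℝ} (hH : 1 < H) : Summable (M.aliveMean z H π fun _ => 1) := by
  obtain ⟨C, hC⟩ := M.exists_difficulty_le π hH
  obtain ⟨B, hB⟩ := exists_abs_le f
  have hC' : ∀ x y, (M.D x (π x) y : ℝ) ≤ |C| * (1 - M.cont H π x y) := fun x y =>
    (hC x y).trans (mul_le_mul_of_nonneg_right (le_abs_self C)
      (sub_nonneg.2 (M.cont_le_one H π x y)))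
  -- In the Lyapunov function, `B` makes `B - f` nonnegative, and the loss of `|C|` on stopping pays
  -- at least the difficulty of the transition. The Poisson equation then leaves a decrease of at
  -- least `c`.
  refine M.summable_aliveMean_one z H π (h := fun x => |C| + B - f x) hc
    (fun x => by linarith [abs_nonneg C, le_of_abs_le (hB x)]) fun x hx => ?_
  have h1 : M.discount H π (fun x => |C| + B - f x) x ≤
      M.mean π (fun x y => |C| + B - (M.D x (π x) y : ℝ) - f y) x := by
    refine M.mean_mono π fun y => ?_
    have h2 := mul_nonneg (sub_nonneg.2 (M.cont_le_one H π x y))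
      (sub_nonneg.2 (le_of_abs_le (hB y)))
    linarith [hC' x y]
  rw [M.mean_sub π (fun x y => |C| + B - (M.D x (π x) y : ℝ)) (fun _ y => f y),
    M.mean_sub π (fun _ _ => |C| + B), M.mean_const π (fun _ => |C| + B)] at h1
  linarith [hf x hx]

/-- The expected total of `g` is `f z` minus the expectation of `f` in the state where the process
stops. Stopping has total mass one, so both terms are at most `B`, whatever `H` is. -/
theorem abs_green_sub_le (M : ARRMDP S A) (π : Policy A) {z : S} {H : ℝ} {g : S → ℝ} {f : S → ℝ}
    {B : ℝ} (hB : ∀ x, |f x| ≤ B)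
    (hf : ∀ x, M.Reach π z x → f x = g x + M.mean π (fun _ y => f y) x)
    (hs : Summable (M.aliveMean z H π fun _ => 1)) : |M.green z H π g| ≤ 2 * B := by
  have e : M.green z H π g =
      f z - M.green z H π (M.mean π fun x y => (1 - M.cont H π x y) * f y) := by
    rw [← green_sub_discount hs f, ← green_sub hs]
    refine green_congr hs fun x hx => ?_
    have : M.mean π (fun x y => (1 - M.cont H π x y) * f y) x =
        M.mean π (fun _ y => f y) x - M.discount H π f x := by
      rw [discount, ← mean_sub]
      exact Finset.sum_congr rfl fun y _ => by ring
    rw [this, hf x hx]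
    ring
  have h2 : |M.green z H π (M.mean π fun x y => (1 - M.cont H π x y) * f y)| ≤ B := by
    have h3 := abs_green_le hs (ψ := M.mean π fun x y => (1 - M.cont H π x y) * f y)
      (χ := fun x => B * M.mean π (fun x y => 1 - M.cont H π x y) x) fun x => by
        rw [← mean_const_mul]
        refine (Finset.abs_sum_le_sum_abs _ _).trans (Finset.sum_le_sum fun y _ => ?_)
        have h1 := sub_nonneg.2 (M.cont_le_one H π x y)
        beta_reduce
        rw [abs_mul, abs_mul, abs_of_nonneg ENNReal.toReal_nonneg, abs_of_nonneg h1, mul_comm B]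
        exact mul_le_mul_of_nonneg_left (mul_le_mul_of_nonneg_left (hB y) h1)
          ENNReal.toReal_nonneg
    rwa [green_const_mul, green_mean_one_sub_cont hs, mul_one] at h3
  rw [e]
  linarith [abs_sub (f z) (M.green z H π (M.mean π fun x y => (1 - M.cont H π x y) * f y)), hB z]

/-- The error is relative to the stopping probability, whose expected total is one; summing over the
whole lifetime therefore does not amplify it. -/
theorem abs_green_difficulty_sub_one_le (M : ARRMDP S A) (π : Policy A) {z : S} {H η : ℝ}
    (hη : ∀ x y, |(M.D x (π x) y : ℝ) / H - (1 - M.cont H π x y)| ≤ η * (1 - M.cont H π x y))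
    (hs : Summable (M.aliveMean z H π fun _ => 1)) :
    |(1 / H) * M.green z H π (M.mean π fun x y => (M.D x (π x) y : ℝ)) - 1| ≤ η := by
  nth_rw 2 [← green_mean_one_sub_cont hs]
  rw [← green_const_mul, ← green_sub hs]
  have h3 := abs_green_le hs (χ := fun x => η * M.mean π (fun x y => 1 - M.cont H π x y) x)
    (ψ := fun x => 1 / H * M.mean π (fun x y => (M.D x (π x) y : ℝ)) x -
      M.mean π (fun x y => 1 - M.cont H π x y) x) fun x => by
      rw [← mean_const_mul, ← mean_const_mul, ← mean_sub]
      refine (Finset.abs_sum_le_sum_abs _ _).trans (Finset.sum_le_sum fun y _ => ?_)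
      beta_reduce
      rw [abs_mul, abs_of_nonneg ENNReal.toReal_nonneg, one_div_mul_eq_div]
      exact mul_le_mul_of_nonneg_left (hη x y) ENNReal.toReal_nonneg
  rwa [green_const_mul, green_mean_one_sub_cont hs, mul_one] at h3

/-- The revenue of the process with termination converges to the quotient of the average reward
and the average difficulty. -/
theorem tendsto_revPT (M : ARRMDP S A) (π : Policy A) {z : S} {fR fD : S → ℝ} {cR cD : ℝ}
    (hcD : 0 < cD)
    (hfR : ∀ x, M.Reach π z x →
      fR x = M.mean π (fun x y => M.R x (π x) y) x - cR + M.mean π (fun _ y => fR y) x)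
    (hfD : ∀ x, M.Reach π z x →
      fD x = M.mean π (fun x y => (M.D x (π x) y : ℝ)) x - cD + M.mean π (fun _ y => fD y) x) :
    Tendsto (fun H => M.revPT z H π) atTop (𝓝 (cR / cD)) := by
  set ρ := cR / cD with hρ
  have hρc : cR = ρ * cD := (div_mul_cancel₀ _ hcD.ne').symm
  -- This combination solves the Poisson equation for reward minus `ρ` times difficulty, whose
  -- constant `cR - ρ * cD` is zero.
  obtain ⟨B, hB⟩ := exists_abs_le fun x => fR x - ρ * fD x
  have hf : ∀ x, M.Reach π z x → fR x - ρ * fD x =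
      (M.mean π (fun x y => M.R x (π x) y) x - ρ * M.mean π (fun x y => (M.D x (π x) y : ℝ)) x) +
        M.mean π (fun _ y => fR y - ρ * fD y) x := fun x hx => by
    rw [M.mean_sub π (fun _ y => fR y) (fun _ y => ρ * fD y),
      M.mean_const_mul π ρ (fun _ y => fD y), hfR x hx, hfD x hx, hρc]
    ring
  have key : ∀ η : ℝ, 0 < η → ∀ᶠ H : ℝ in atTop,
      |M.revPT z H π - ρ| ≤ 2 * B / H + |ρ| * η := by
    intro η hη
    have hev : ∀ᶠ H : ℝ in atTop, ∀ x y,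
        |(M.D x (π x) y : ℝ) / H - (1 - M.cont H π x y)| ≤ η * (1 - M.cont H π x y) :=
      eventually_all.2 fun x => eventually_all.2 fun y => eventually_abs_sub_le _ hη
    filter_upwards [hev, eventually_gt_atTop 1] with H h1 hH
    have hs := M.summable_aliveMean_one_of_poisson π hcD hfD hH
    have h2 := M.abs_green_difficulty_sub_one_le π h1 hs
    have h3 := M.abs_green_sub_le π hB hf hs
    rw [green_sub hs, green_const_mul] at h3
    rw [revPT_eq_green hs]
    generalize M.green z H π (M.mean π fun x y => M.R x (π x) y) = a at *
    generalize M.green z H π (M.mean π fun x y => (M.D x (π x) y : ℝ)) = b at *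
    have e : 1 / H * a - ρ = (a - ρ * b) / H + ρ * (1 / H * b - 1) := by ring
    rw [e]
    refine (abs_add_le _ _).trans (add_le_add ?_ ?_)
    · rw [abs_div, abs_of_pos (by linarith : 0 < H)]
      exact div_le_div_of_nonneg_right h3 (by linarith)
    · rw [abs_mul]
      exact mul_le_mul_of_nonneg_left h2 (abs_nonneg _)
  rw [Metric.tendsto_nhds]
  intro ε hε
  have hinv : Tendsto (fun H : ℝ => 2 * B / H) atTop (𝓝 0) :=
    tendsto_const_nhds.div_atTop tendsto_id
  -- The summand `1` covers the case `ρ = 0`.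
  have hη : 0 < ε / (2 * (|ρ| + 1)) := by positivity
  filter_upwards [key _ hη, hinv.eventually (gt_mem_nhds (half_pos hε))] with H h1 h2
  have h3 : |ρ| * (ε / (2 * (|ρ| + 1))) ≤ ε / 2 := by
    rw [mul_div_assoc', div_le_div_iff₀ (by positivity) two_pos]
    nlinarith [abs_nonneg ρ]
  rw [Real.dist_eq]
  linarith

end Asymptotics

/-! ### The ratio objective, and both limits for a fixed policy. -/

section Ratio

variable {S : Type*} {A : S → Type*} [Fintype S] [MeasurableSpace S] [MeasurableSingletonClass S]

theorem meanDifficulty_eq (M : ARRMDP S A) (π : Policy A) {z : S} {fD : S → ℝ} {cD : ℝ}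
    (hfD : ∀ x, M.Reach π z x →
      fD x = M.mean π (fun x y => (M.D x (π x) y : ℝ)) x - cD + M.mean π (fun _ y => fD y) x) :
    M.meanDifficulty z π = cD := by
  have h : ∀ᵐ ω ∂(M.law π z), limUnder atTop (M.avgDifficulty π ω) = cD := by
    filter_upwards [M.ae_tendsto_avg π hfD] with ω hω
    refine Tendsto.limUnder_eq (hω.congr fun T => ?_)
    rw [avgDifficulty, one_div_mul_eq_div]
    rfl
  rw [meanDifficulty, integral_congr_ae h]
  simp

theorem ae_tendsto_ratio (M : ARRMDP S A) (π : Policy A) {z : S} {fR fD : S → ℝ} {cR cD : ℝ}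
    (hcD : 0 < cD)
    (hfR : ∀ x, M.Reach π z x →
      fR x = M.mean π (fun x y => M.R x (π x) y) x - cR + M.mean π (fun _ y => fR y) x)
    (hfD : ∀ x, M.Reach π z x →
      fD x = M.mean π (fun x y => (M.D x (π x) y : ℝ)) x - cD + M.mean π (fun _ y => fD y) x) :
    ∀ᵐ ω ∂(M.law π z), Tendsto (M.ratio π ω) atTop (𝓝 (cR / cD)) := by
  filter_upwards [M.ae_tendsto_avg π hfR, M.ae_tendsto_avg π hfD] with ω hR hD
  refine (hR.div hD hcD.ne').congr' ?_
  filter_upwards [eventually_ge_atTop 1] with T hT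
  exact div_div_div_cancel_right₀ (by positivity) _ _

/-- The limits of both objectives, for a fixed policy. -/
theorem exists_limit (M : ARRMDP S A) (π : Policy A) {z : S}
    (hrec : M.PositiveRecurrent π z) (hD : 0 < M.meanDifficulty z π) :
    ∃ ρ : ℝ, (∀ᵐ ω ∂(M.law π z), Tendsto (M.ratio π ω) atTop (𝓝 ρ)) ∧
      Tendsto (fun H => M.revPT z H π) atTop (𝓝 ρ) ∧
      ∀ H, 1 < H → Summable (M.aliveMean z H π fun _ => 1) := by
  have hz : ∀ x, M.Reach π z x → M.Reach π x z := fun x hx => M.reach_symm_of_recurrent π hrec.1 hx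
  obtain ⟨fR, cR, hfR⟩ := M.exists_poisson π hz (M.mean π fun x y => M.R x (π x) y)
  obtain ⟨fD, cD, hfD⟩ := M.exists_poisson π hz (M.mean π fun x y => (M.D x (π x) y : ℝ))
  rw [M.meanDifficulty_eq π hfD] at hD
  exact ⟨cR / cD, M.ae_tendsto_ratio π hD hfR hfD, M.tendsto_revPT π hD hfR hfD,
    fun H hH => M.summable_aliveMean_one_of_poisson π hD hfD hH⟩

end Ratio

end

end ARRMDP

theorem mainTheorem2 {S : Type*} {A : S → Type*} [Fintype S] [DecidableEq S]
    [MeasurableSpace S] [MeasurableSingletonClass S]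
    [∀ s, Fintype (A s)] [∀ s, Nonempty (A s)]
    (M : ARRMDP S A) (sinit : S)
    (hR : ∃ Rmax : ℝ, 0 < Rmax ∧ ∀ (π : ARRMDP.Policy A) (t : ℕ),
      ∀ᵐ ω ∂(M.law π sinit), |M.reward π t ω| ≤ Rmax)
    (hD : ∃ Dmax : ℝ, 0 < Dmax ∧ ∀ (π : ARRMDP.Policy A) (t : ℕ),
      ∀ᵐ ω ∂(M.law π sinit), 0 ≤ M.difficulty π t ω ∧ M.difficulty π t ω ≤ Dmax)
    (hε : ∃ ε : ℝ, 0 < ε ∧ ∀ π : ARRMDP.Policy A, ε < M.meanDifficulty sinit π)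
    (hrec : ∀ π : ARRMDP.Policy A, M.PositiveRecurrent π sinit) :
    -- the two revenues are well defined
    (∀ π : ARRMDP.Policy A,
      (∀ᵐ ω ∂(M.law π sinit), ∃ l : ℝ, Tendsto (M.ratio π ω) atTop (𝓝 l)) ∧
      Integrable (fun ω => limUnder atTop (M.ratio π ω)) (M.law π sinit)) ∧
    (∀ (H : ℝ) (π : ARRMDP.Policy A), 1 < H →
      (∀ᵐ ω ∂(M.ptLaw sinit H π), ∃ t, 1 ≤ t ∧ (ω t).2 = false) ∧
      Integrable (M.ptTotal H π) (M.ptLaw sinit H π)) ∧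
    -- the optimal revenues converge
    Tendsto (fun H : ℝ => ARRMDP.maxPolicy (M.revPT sinit H)) atTop
      (𝓝 (ARRMDP.maxPolicy (M.revARR sinit))) ∧
    -- policies that are optimal with termination are nearly optimal for the ratio objective
    (∀ δ : ℝ, 0 < δ → ∀ᶠ H : ℝ in atTop, ∀ π : ARRMDP.Policy A,
      (∀ π' : ARRMDP.Policy A, M.revPT sinit H π' ≤ M.revPT sinit H π) →
      ARRMDP.maxPolicy (M.revARR sinit) - δ < M.revARR sinit π) := by
  obtain ⟨ε, hε0, hε⟩ := hε
  choose ρ hratio hPT hs using fun π => M.exists_limit π (hrec π) (hε0.trans (hε π))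
  have hlim : ∀ π, (fun ω => limUnder atTop (M.ratio π ω)) =ᵐ[M.law π sinit] fun _ => ρ π :=
    fun π => (hratio π).mono fun ω h => h.limUnder_eq
  have hARR : ∀ π, M.revARR sinit π = ρ π := fun π => by
    rw [ARRMDP.revARR, integral_congr_ae (hlim π)]
    simp
  have hconv : ∀ π, Tendsto (fun H => M.revPT sinit H π) atTop (𝓝 (M.revARR sinit π)) :=
    fun π => (hARR π).symm ▸ hPT π
  refine ⟨fun π => ⟨(hratio π).mono fun ω h => ⟨ρ π, h⟩,
    (integrable_const (ρ π)).congr (hlim π).symm⟩,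
    fun H π hH => ⟨ARRMDP.ae_exists_term (hs π H hH), ARRMDP.integrable_ptTotal (hs π H hH)⟩,
    Tendsto.finset_sup'_nhds_apply _ fun π _ => hconv π, fun δ hδ => ?_⟩
  -- Uniform over the finitely many policies. Passing from a competitor to its terminated revenue,
  -- and from that of the maximizer back, costs less than `δ / 2` each.
  have hclose : ∀ᶠ H : ℝ in atTop, ∀ π, |M.revPT sinit H π - M.revARR sinit π| < δ / 2 :=
    eventually_all.2 fun π => (Metric.tendsto_nhds.1 (hconv π)) _ (half_pos hδ)
  filter_upwards [hclose] with H hH π hπ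
  rw [ARRMDP.maxPolicy, sub_lt_iff_lt_add, Finset.sup'_lt_iff]
  intro π' _
  linarith [(abs_lt.1 (hH π)).2, (abs_lt.1 (hH π')).1, hπ π']
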